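/- **Setting.** Let $(V,E)$ be a finite directed graph with link capacities $C_{ij}\ge 0$, a destination $d\in V$ and a maximum lifetime $L$; let $\mathcal L=\{1,\dots,L\}$. In each slot $t=0,1,2,\dots$, amounts $a_i^{(l)}(t)\in[0,A_{\max}]$ of packets with lifetime $l\in\mathcal L$ arrive at the nodes $i\in V$, with $a_d^{(l)}(t)=0$; the arrival vectors are i.i.d. over time with mean $\lambda=(\lambda_i^{(l)})$. Write $\overline{z}=\lim_{T\to\infty}\frac1T\sum_{t=0}^{T-1}z(t)$. A policy chooses in each slot a real flow vector $x(t)=(x_{ij}^{(l)}(t))_{(i,j)\in E,\,l\in\mathcal L}$ with $x(t)\ge 0$. The choice depends only on the information available before the arrivals of slot $t$ (past arrivals and randomization that is independent of present and future arrivals). The destination sends nothing, $x_{dk}^{(l)}(t)=0$; packets of lifetime $1$ are sent only to $d$, that is $x_{ij}^{(1)}(t)=0$ for $j\neq d$; and the averages $\overline{\mathbb E\,x_{ij}^{(l)}(t)}$ exist. The vector $\overline{\mathbb E\,x(t)}$ is the flow assignment achieved by the policy. Let $x_{i\to}^{(l)}=\sum_{j:(i,j)\in E}x_{ij}^{(l)}$,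 $x_{\to i}^{(l)}=\sum_{j:(j,i)\in E}x_{ji}^{(l)}$, $x_{ij}=\sum_{l\in\mathcal L}x_{ij}^{(l)}$ and $x_{\to d}=\sum_{l\in\mathcal L}x_{\to d}^{(l)}$; the superscript $(\ge l)$ denotes the sum over lifetimes $l,\dots,L$. Let $\gamma\in\mathbb R$ be the required reliability level. The policy is feasible for the average-capacity-constrained problem $\mathscr P_1$ if $$\overline{\mathbb E\,x_{\to d}(t)}\ \ge\ \gamma\|\lambda\|_1,\qquad \overline{\mathbb E\,x_{ij}(t)}\le C_{ij}\ \ \forall (i,j)\in E,\qquad x_{i\to}^{(l)}(t)\le Q_i^{(l)}(t)\ \ \forall i\in V,\ l\in\mathcal L,\ t\ge 0,$$ where $Q(0)=0$, $Q_d^{(l)}(t)=0$, and, for $i\ne d$ and $l\in\mathcal L$, $Q_i^{(l)}(t+1)=Q_i^{(l+1)}(t)-x_{i\to}^{(l+1)}(t)+x_{\to i}^{(l+1)}(t)+a_i^{(l)}(t)$ (terms of lifetime $L+1$ are $0$). It is feasible for the virtual-network problem $\mathscr P_2$ if $$\overline{\mathbb E\,x_{\to d}(t)}\ \ge\ \gamma\|\lambda\|_1,\qquad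 x_{ij}(t)\le C_{ij}\ \ \forall (i,j)\in E,\ t\ge 0,\qquad \overline{\mathbb E\,x_{i\to}^{(\ge l)}(t)}\le\overline{\mathbb E\,x_{\to i}^{(\ge l+1)}(t)}+\lambda_i^{(\ge l)}\ \ \forall i\in V,\ l\in\mathcal L.$$ Pathwise constraints are required almost surely. For $\iota=1,2$ the stability region $\Lambda_\iota$ is the set of pairs $(\lambda,\gamma)$ for which $\mathscr P_\iota$ has a feasible policy (for some arrival process with mean $\lambda$), and the flow space $\Gamma_\iota$ is the set of flow assignments achieved by feasible policies of $\mathscr P_\iota$. **Proposition.** $\Lambda_1=\Lambda_2$, and for every $(\lambda,\gamma)\in\Lambda_1=\Lambda_2$ (and every arrival process with mean rate $\lambda$) the two problems have identical flow spaces, $\Gamma_1=\Gamma_2$. -/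

import Mathlib

open MeasureTheory ProbabilityTheory Filter Topology

universe v u

/-- A packet routing network: a finite directed graph with link capacities, a destination and a
maximum packet lifetime. Lifetimes are natural numbers; the effective ones are `1, …, L`. -/
structure Network (V : Type*) where
  graph : Digraph V
  dest : V
  L : ℕ
  cap : V → V → ℝ
  cap_nonneg : ∀ i j, 0 ≤ cap i j

/-- The value `z` is the long-term average `lim (1/T) ∑_{t<T} u t` (in particular the limit
exists). -/
def IsLongRunAvg (u : ℕ → ℝ) (z : ℝ) : Prop :=
  Tendsto (fun T : ℕ => (∑ t ∈ Finset.range T, u t) / (T : ℝ)) atTop (𝓝 z)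

namespace Network

variable {V : Type*} [Fintype V] (N : Network V)

/-- Flow vectors: `x i j l` is the amount of lifetime-`l` packets sent over the link `(i, j)`. -/
abbrev Flow (V : Type*) := V → V → ℕ → ℝ

open Classical in
/-- Outgoing neighbours of a node. -/
noncomputable def outNbrs (i : V) : Finset V := Finset.univ.filter fun j => N.graph.Adj i j

open Classical in
/-- Incoming neighbours of a node. -/
noncomputable def inNbrs (i : V) : Finset V := Finset.univ.filter fun j => N.graph.Adj j i

/-- Lifetime-`l` packets leaving node `i`. -/
noncomputable def outflow (x : Flow V) (i : V) (l : ℕ) : ℝ := ∑ j ∈ N.outNbrs i, x i j l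

/-- Lifetime-`l` packets sent to node `i` by its neighbours. -/
noncomputable def inflow (x : Flow V) (i : V) (l : ℕ) : ℝ := ∑ j ∈ N.inNbrs i, x j i l

/-- Packets of lifetime at least `l` leaving node `i`. -/
noncomputable def outflowGE (x : Flow V) (i : V) (l : ℕ) : ℝ :=
  ∑ k ∈ Finset.Icc l N.L, N.outflow x i k

/-- Packets of lifetime at least `l` sent to node `i`. -/
noncomputable def inflowGE (x : Flow V) (i : V) (l : ℕ) : ℝ :=
  ∑ k ∈ Finset.Icc l N.L, N.inflow x i k

/-- Total flow on the link `(i, j)`, over all lifetimes. -/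
def linkFlow (x : Flow V) (i j : V) : ℝ := ∑ l ∈ Finset.Icc 1 N.L, x i j l

/-- The standing conventions on a flow decision: it is non-negative; it lives on the links of the
graph and on lifetimes `1, …, L`; the destination, where packets are consumed, sends nothing; and
packets of lifetime `1` are sent to the destination only. -/
structure IsDecision (x : Flow V) : Prop where
  nonneg : ∀ i j l, 0 ≤ x i j l
  off_links : ∀ i j l, ¬ N.graph.Adj i j → x i j l = 0
  off_lifetimes : ∀ i j l, l ∉ Finset.Icc 1 N.L → x i j l = 0
  dest_silent : ∀ j l, x N.dest j l = 0
  lifetime_one : ∀ i j, j ≠ N.dest → x i j 1 = 0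

open Classical in
/-- Backlog of lifetime-`l` packets at node `i` at the beginning of slot `t`, starting from an empty
network, when `x` are the decisions and `a` the exogenous arrivals along one sample path.
Outdated packets are dropped and the destination consumes packets immediately. -/
noncomputable def queue (x : ℕ → Flow V) (a : ℕ → V → ℕ → ℝ) : ℕ → V → ℕ → ℝ
  | 0, _, _ => 0
  | t + 1, i, l =>
    if i ≠ N.dest ∧ l ∈ Finset.Icc 1 N.L then
      queue x a t i (l + 1) - N.outflow (x t) i (l + 1) + N.inflow (x t) i (l + 1) + a t i l
    else 0

/-- A bounded arrival process, independent and identically distributed over time, on a probability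
space with a filtration. `past t` is the information (past arrivals and any randomization of the
controller) on which the decision of slot `t` may depend; the arrivals of slot `t`, which come in
after that decision, are independent of it. `arr t ω i l` is the amount of packets of initial
lifetime `l` that enter at node `i` in slot `t`. -/
structure Arrivals {V : Type v} [Fintype V] (N : Network V) where
  Ω : Type u
  [mΩ : MeasurableSpace Ω]
  μ : Measure Ω
  [prob : IsProbabilityMeasure μ]
  past : Filtration ℕ mΩ
  arr : ℕ → Ω → V → ℕ → ℝ
  observed : ∀ t, Measurable[past (t + 1)] (arr t)
  indep_past : ∀ t, Indep (MeasurableSpace.comap (arr t) inferInstance) (past t) μ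
  indep : iIndepFun arr μ
  identDistrib : ∀ t, IdentDistrib (arr t) (arr 0) μ μ
  bounded : ∃ Amax : ℝ, ∀ t, ∀ᵐ ω ∂μ, ∀ i l, 0 ≤ arr t ω i l ∧ arr t ω i l ≤ Amax
  off_lifetimes : ∀ t, ∀ᵐ ω ∂μ, ∀ i l, l ∉ Finset.Icc 1 N.L → arr t ω i l = 0
  dest_no_source : ∀ t, ∀ᵐ ω ∂μ, ∀ l, arr t ω N.dest l = 0

attribute [instance] Arrivals.mΩ Arrivals.prob

namespace Arrivals

variable {N} (S : N.Arrivals)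

/-- The mean arrival rate vector. -/
noncomputable def rate (i : V) (l : ℕ) : ℝ := ∫ ω, S.arr 0 ω i l ∂S.μ

/-- Mean arrival rate at node `i` of packets of lifetime at least `l`. -/
noncomputable def rateGE (i : V) (l : ℕ) : ℝ := ∑ k ∈ Finset.Icc l N.L, S.rate i k

/-- The `ℓ¹` norm of the arrival rate vector. -/
noncomputable def totalRate : ℝ := ∑ i, ∑ l ∈ Finset.Icc 1 N.L, |S.rate i l|

/-- A control policy, given by its decisions: in each slot the decision is a function of the
available information, it satisfies the standing conventions, and the long-term averages of
the expected flows exist. -/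
structure Policy where
  x : ℕ → S.Ω → Flow V
  measurable : ∀ t, Measurable[S.past t] (x t)
  decision : ∀ t, ∀ᵐ ω ∂S.μ, N.IsDecision (x t ω)
  avg_exists : ∀ i j l, ∃ z, IsLongRunAvg (fun t => ∫ ω, x t ω i j l ∂S.μ) z

variable {S}

/-- The vector `z` is the flow assignment achieved by the policy: the long-term average of its
expected decisions. -/
def Policy.Achieves (p : S.Policy) (z : Flow V) : Prop :=
  ∀ i j l, IsLongRunAvg (fun t => ∫ ω, p.x t ω i j l ∂S.μ) (z i j l)

/-- The reliability constraint: the timely throughput is at least a fraction `γ` of the total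
arrival rate. -/
def Policy.Reliable (p : S.Policy) (γ : ℝ) : Prop :=
  ∃ r, IsLongRunAvg (fun t => ∫ ω, N.inflowGE (p.x t ω) N.dest 1 ∂S.μ) r ∧ γ * S.totalRate ≤ r

/-- Feasibility for the average-capacity-constrained problem: reliability, average capacity and
availability of the sent packets in the lifetime queues. -/
structure Policy.Feasible₁ (p : S.Policy) (γ : ℝ) : Prop where
  reliable : p.Reliable γ
  avg_capacity : ∀ i j, N.graph.Adj i j →
    ∃ c, IsLongRunAvg (fun t => ∫ ω, N.linkFlow (p.x t ω) i j ∂S.μ) c ∧ c ≤ N.cap i j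
  available : ∀ t, ∀ᵐ ω ∂S.μ, ∀ i, ∀ l ∈ Finset.Icc 1 N.L,
    N.outflow (p.x t ω) i l ≤ N.queue (fun s => p.x s ω) (fun s => S.arr s ω) t i l

/-- Feasibility for the virtual-network problem: reliability, peak capacity and causality. -/
structure Policy.Feasible₂ (p : S.Policy) (γ : ℝ) : Prop where
  reliable : p.Reliable γ
  peak_capacity : ∀ t, ∀ᵐ ω ∂S.μ, ∀ i j, N.graph.Adj i j → N.linkFlow (p.x t ω) i j ≤ N.cap i j
  causal : ∀ i, ∀ l ∈ Finset.Icc 1 N.L, ∃ u v,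
    IsLongRunAvg (fun t => ∫ ω, N.outflowGE (p.x t ω) i l ∂S.μ) u ∧
    IsLongRunAvg (fun t => ∫ ω, N.inflowGE (p.x t ω) i (l + 1) ∂S.μ) v ∧
    u ≤ v + S.rateGE i l

variable (S)

/-- The flow space of the average-capacity-constrained problem. -/
def flowSpace₁ (γ : ℝ) : Set (Flow V) := {z | ∃ p : S.Policy, p.Feasible₁ γ ∧ p.Achieves z}

/-- The flow space of the virtual-network problem. -/
def flowSpace₂ (γ : ℝ) : Set (Flow V) := {z | ∃ p : S.Policy, p.Feasible₂ γ ∧ p.Achieves z}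

end Arrivals

/-- The stability region of the average-capacity-constrained problem: the pairs of an arrival rate
vector and a reliability level for which a feasible policy exists. -/
def stabilityRegion₁ : Set ((V → ℕ → ℝ) × ℝ) :=
  {q | ∃ S : Arrivals.{_, 0} N, S.rate = q.1 ∧ ∃ p : S.Policy, p.Feasible₁ q.2}

/-- The stability region of the virtual-network problem. -/
def stabilityRegion₂ : Set ((V → ℕ → ℝ) × ℝ) :=
  {q | ∃ S : Arrivals.{_, 0} N, S.rate = q.1 ∧ ∃ p : S.Policy, p.Feasible₂ q.2}

end Network

/-! Both flow spaces coincide with one explicit polytope, `IsAssignment`: the vectors that satisfy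
the decision conventions, the link capacities, causality and reliability (`flowSpace₁_eq`,
`flowSpace₂_eq`). Necessity is averaging. The one constraint of the first problem that is not
already an average, availability, yields causality: the expected backlog of lifetime at least `l` is
a nonnegative potential that starts at `0`, so its increments telescope (`Policy.Feasible₁.causal`).
For sufficiency in the virtual network, `z` is sent in every slot. In the first problem, each node
sends the fixed fraction `z i j l / meanBacklog z i l` of its actual backlog; causality says exactly
that these fractions add up to at most `1`. The dynamics are then linear, and lifetimes only
decrease, so the mean backlogs settle at `meanBacklog` after finitely many slots and the mean flow
equals `z` exactly from slot `L` on (`IsAssignment.integral_proportionalFlow`). Regions reduce to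
nonemptiness of flow spaces. -/

section LongRunAvg

/-! ### Calculus of long-term averages. -/

lemma IsLongRunAvg.unique {u : ℕ → ℝ} {y z : ℝ} (hy : IsLongRunAvg u y)
    (hz : IsLongRunAvg u z) : y = z :=
  tendsto_nhds_unique hy hz

lemma IsLongRunAvg.of_tendsto {u : ℕ → ℝ} {z : ℝ} (h : Tendsto u atTop (𝓝 z)) :
    IsLongRunAvg u z := by
  have := h.cesaro
  unfold IsLongRunAvg
  simpa [div_eq_inv_mul] using this

lemma IsLongRunAvg.const (z : ℝ) : IsLongRunAvg (fun _ => z) z :=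
  .of_tendsto tendsto_const_nhds

lemma IsLongRunAvg.add {u v : ℕ → ℝ} {y z : ℝ} (hy : IsLongRunAvg u y)
    (hz : IsLongRunAvg v z) : IsLongRunAvg (fun t => u t + v t) (y + z) := by
  unfold IsLongRunAvg
  simpa only [Finset.sum_add_distrib, add_div] using Tendsto.add hy hz

lemma IsLongRunAvg.sum {ι : Type*} {s : Finset ι} {u : ι → ℕ → ℝ} {z : ι → ℝ}
    (h : ∀ i ∈ s, IsLongRunAvg (u i) (z i)) :
    IsLongRunAvg (fun t => ∑ i ∈ s, u i t) (∑ i ∈ s, z i) := by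
  have := tendsto_finsetSum s h
  unfold IsLongRunAvg
  refine this.congr fun T => ?_
  rw [Finset.sum_comm, Finset.sum_div]

/-- Comparison of long-term averages when the sequences are ordered up to the increments of a
non-negative potential that starts from `0`. -/
lemma IsLongRunAvg.le_of_potential {u v q : ℕ → ℝ} {y z : ℝ} (hy : IsLongRunAvg u y)
    (hz : IsLongRunAvg v z) (q_zero : q 0 = 0) (q_nonneg : ∀ t, 0 ≤ q t)
    (h : ∀ t, q (t + 1) + u t ≤ q t + v t) : y ≤ z := by
  have key : ∀ T, q T + ∑ t ∈ Finset.range T, u t ≤ ∑ t ∈ Finset.range T, v t := by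
    intro T
    induction T with
    | zero => simp [q_zero]
    | succ T ih =>
      rw [Finset.sum_range_succ, Finset.sum_range_succ]
      linarith [h T]
  refine le_of_tendsto_of_tendsto' hy hz fun T => ?_
  have := key T
  have := q_nonneg T
  exact div_le_div_of_nonneg_right (by linarith) T.cast_nonneg

lemma IsLongRunAvg.nonneg {u : ℕ → ℝ} {z : ℝ} (hz : IsLongRunAvg u z) (h : ∀ t, 0 ≤ u t) :
    0 ≤ z :=
  (IsLongRunAvg.const 0).le_of_potential hz (q := fun _ => 0) rfl (fun _ => le_rfl)
    (by simpa using h)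

end LongRunAvg

namespace Network

/-! ### Flows and queue dynamics along one sample path. -/

section Flow

variable {V : Type*} [Fintype V] {N : Network V}

lemma mem_outNbrs {i j : V} : j ∈ N.outNbrs i ↔ N.graph.Adj i j := by
  simp [outNbrs]

lemma IsDecision.outflow_nonneg {x : Flow V} (hx : N.IsDecision x) (i : V) (l : ℕ) :
    0 ≤ N.outflow x i l :=
  Finset.sum_nonneg fun j _ => hx.nonneg i j l

lemma IsDecision.inflow_nonneg {x : Flow V} (hx : N.IsDecision x) (i : V) (l : ℕ) :
    0 ≤ N.inflow x i l :=
  Finset.sum_nonneg fun j _ => hx.nonneg j i l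

lemma IsDecision.inflowGE_nonneg {x : Flow V} (hx : N.IsDecision x) (i : V) (l : ℕ) :
    0 ≤ N.inflowGE x i l :=
  Finset.sum_nonneg fun k _ => hx.inflow_nonneg i k

lemma IsDecision.outflow_off {x : Flow V} (hx : N.IsDecision x) (i : V) {l : ℕ}
    (hl : l ∉ Finset.Icc 1 N.L) : N.outflow x i l = 0 :=
  Finset.sum_eq_zero fun j _ => hx.off_lifetimes i j l hl

lemma IsDecision.inflow_off {x : Flow V} (hx : N.IsDecision x) (i : V) {l : ℕ}
    (hl : l ∉ Finset.Icc 1 N.L) : N.inflow x i l = 0 :=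
  Finset.sum_eq_zero fun j _ => hx.off_lifetimes j i l hl

lemma IsDecision.outflow_dest {x : Flow V} (hx : N.IsDecision x) (l : ℕ) :
    N.outflow x N.dest l = 0 :=
  Finset.sum_eq_zero fun j _ => hx.dest_silent j l

lemma IsDecision.le_outflow {x : Flow V} (hx : N.IsDecision x) (i j : V) (l : ℕ) :
    x i j l ≤ N.outflow x i l := by
  by_cases h : N.graph.Adj i j
  · exact Finset.single_le_sum (f := fun j => x i j l) (fun j _ => hx.nonneg i j l)
      (mem_outNbrs.2 h)
  · rw [hx.off_links i j l h]
    exact hx.outflow_nonneg i l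

omit [Fintype V] in
lemma IsDecision.le_linkFlow {x : Flow V} (hx : N.IsDecision x) (i j : V) (l : ℕ) :
    x i j l ≤ N.linkFlow x i j := by
  by_cases h : l ∈ Finset.Icc 1 N.L
  · exact Finset.single_le_sum (f := fun l => x i j l) (fun l _ => hx.nonneg i j l) h
  · rw [hx.off_lifetimes i j l h]
    exact Finset.sum_nonneg fun l _ => hx.nonneg i j l

@[simp]
lemma queue_zero (x : ℕ → Flow V) (a : ℕ → V → ℕ → ℝ) (i : V) (l : ℕ) :
    N.queue x a 0 i l = 0 := by
  simp [queue]

lemma queue_off (x : ℕ → Flow V) (a : ℕ → V → ℕ → ℝ) (t : ℕ) (i : V) {l : ℕ}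
    (hl : l ∉ Finset.Icc 1 N.L) : N.queue x a t i l = 0 := by
  cases t with
  | zero => simp
  | succ t => rw [queue, if_neg fun h => hl h.2]

lemma queue_succ (x : ℕ → Flow V) (a : ℕ → V → ℕ → ℝ) (t : ℕ) {i : V} (hi : i ≠ N.dest) {l : ℕ}
    (hl : l ∈ Finset.Icc 1 N.L) :
    N.queue x a (t + 1) i l = N.queue x a t i (l + 1) - N.outflow (x t) i (l + 1)
      + N.inflow (x t) i (l + 1) + a t i l := by
  rw [queue, if_pos ⟨hi, hl⟩]

lemma sum_Icc_shift {f : ℕ → ℝ} {l L : ℕ} (hl : l ≤ L) (hL : f (L + 1) = 0) :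
    ∑ k ∈ Finset.Icc l L, f (k + 1) = ∑ k ∈ Finset.Icc (l + 1) L, f k := by
  rw [← add_zero (∑ k ∈ Finset.Icc (l + 1) L, f k), ← hL,
    ← Finset.sum_Icc_succ_top (Nat.succ_le_succ hl), Nat.succ_eq_add_one,
    ← Finset.map_add_right_Icc, Finset.sum_map]
  rfl

lemma sum_Icc_eq_add {f : ℕ → ℝ} {l L : ℕ} (hl : l ≤ L) :
    ∑ k ∈ Finset.Icc l L, f k = f l + ∑ k ∈ Finset.Icc (l + 1) L, f k := by
  rw [← Finset.insert_Icc_add_one_left_eq_Icc hl, Finset.sum_insert (by simp)]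

/-- One-slot drift of the backlog of packets of lifetime at least `l`. -/
lemma sum_queue_succ_add_outflowGE_le {x : ℕ → Flow V} {a : ℕ → V → ℕ → ℝ} {t : ℕ} {i : V}
    (hx : N.IsDecision (x t)) (hi : i ≠ N.dest) {l : ℕ} (hl : l ∈ Finset.Icc 1 N.L)
    (hav : N.outflow (x t) i l ≤ N.queue x a t i l) :
    ∑ k ∈ Finset.Icc l N.L, N.queue x a (t + 1) i k + N.outflowGE (x t) i l
      ≤ ∑ k ∈ Finset.Icc l N.L, N.queue x a t i k
        + (N.inflowGE (x t) i (l + 1) + ∑ k ∈ Finset.Icc l N.L, a t i k) := by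
  have hl' := Finset.mem_Icc.1 hl
  have hL : N.L + 1 ∉ Finset.Icc 1 N.L := by simp
  have e : ∑ k ∈ Finset.Icc l N.L, N.queue x a (t + 1) i k
      = ∑ k ∈ Finset.Icc (l + 1) N.L, N.queue x a t i k - N.outflowGE (x t) i (l + 1)
        + N.inflowGE (x t) i (l + 1) + ∑ k ∈ Finset.Icc l N.L, a t i k := by
    rw [Finset.sum_congr rfl fun k hk => queue_succ x a t hi
      (Finset.mem_Icc.2 ⟨hl'.1.trans (Finset.mem_Icc.1 hk).1, (Finset.mem_Icc.1 hk).2⟩)]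
    rw [Finset.sum_add_distrib, Finset.sum_add_distrib, Finset.sum_sub_distrib,
      sum_Icc_shift hl'.2 (queue_off x a t i hL), sum_Icc_shift hl'.2 (hx.outflow_off i hL),
      sum_Icc_shift hl'.2 (hx.inflow_off i hL)]
    rfl
  have eq : ∑ k ∈ Finset.Icc l N.L, N.queue x a t i k
      = N.queue x a t i l + ∑ k ∈ Finset.Icc (l + 1) N.L, N.queue x a t i k :=
    sum_Icc_eq_add hl'.2
  have eo : N.outflowGE (x t) i l = N.outflow (x t) i l + N.outflowGE (x t) i (l + 1) :=
    sum_Icc_eq_add hl'.2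
  -- The unsent packets of lifetime `l` leave the sum when they age; `hav` makes their amount
  -- nonnegative, which is the slack in the inequality.
  linarith

end Flow

/-! ### Expectations of arrivals, flows and backlogs. -/

namespace Arrivals

variable {V : Type*} [Fintype V] {N : Network V} {S : N.Arrivals}

lemma measurable_arr (S : N.Arrivals) (t : ℕ) (i : V) (l : ℕ) :
    Measurable[S.past (t + 1)] fun ω => S.arr t ω i l :=
  (measurable_pi_apply l).comp ((measurable_pi_apply i).comp (S.observed t))

lemma integrable_arr (S : N.Arrivals) (t : ℕ) (i : V) (l : ℕ) :
    Integrable (fun ω => S.arr t ω i l) S.μ := by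
  obtain ⟨A, hA⟩ := S.bounded
  refine Integrable.of_bound
    ((S.measurable_arr t i l).mono (S.past.le _) le_rfl).aestronglyMeasurable A ?_
  filter_upwards [hA t] with ω hω
  rw [Real.norm_of_nonneg (hω i l).1]
  exact (hω i l).2

lemma integral_arr (S : N.Arrivals) (t : ℕ) (i : V) (l : ℕ) :
    ∫ ω, S.arr t ω i l ∂S.μ = S.rate i l :=
  ((S.identDistrib t).comp (u := fun a : V → ℕ → ℝ => a i l) (by fun_prop)).integral_eq

lemma rate_nonneg (S : N.Arrivals) (i : V) (l : ℕ) : 0 ≤ S.rate i l := by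
  obtain ⟨A, hA⟩ := S.bounded
  exact integral_nonneg_of_ae ((hA 0).mono fun ω hω => (hω i l).1)

lemma rateGE_nonneg (S : N.Arrivals) (i : V) (l : ℕ) : 0 ≤ S.rateGE i l :=
  Finset.sum_nonneg fun k _ => S.rate_nonneg i k

section Integrals

variable {y : S.Ω → Flow V}

lemma integrable_outflow (h : ∀ i j l, Integrable (fun ω => y ω i j l) S.μ)
    (i : V) (l : ℕ) : Integrable (fun ω => N.outflow (y ω) i l) S.μ :=
  integrable_finsetSum _ fun j _ => h i j l

lemma integrable_inflow (h : ∀ i j l, Integrable (fun ω => y ω i j l) S.μ)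
    (i : V) (l : ℕ) : Integrable (fun ω => N.inflow (y ω) i l) S.μ :=
  integrable_finsetSum _ fun j _ => h j i l

lemma integrable_outflowGE (h : ∀ i j l, Integrable (fun ω => y ω i j l) S.μ)
    (i : V) (l : ℕ) : Integrable (fun ω => N.outflowGE (y ω) i l) S.μ :=
  integrable_finsetSum _ fun k _ => integrable_outflow h i k

lemma integrable_inflowGE (h : ∀ i j l, Integrable (fun ω => y ω i j l) S.μ)
    (i : V) (l : ℕ) : Integrable (fun ω => N.inflowGE (y ω) i l) S.μ :=
  integrable_finsetSum _ fun k _ => integrable_inflow h i k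

lemma integral_outflow (h : ∀ i j l, Integrable (fun ω => y ω i j l) S.μ)
    (i : V) (l : ℕ) :
    ∫ ω, N.outflow (y ω) i l ∂S.μ = N.outflow (fun i j l => ∫ ω, y ω i j l ∂S.μ) i l :=
  integral_finsetSum _ fun j _ => h i j l

lemma integral_inflow (h : ∀ i j l, Integrable (fun ω => y ω i j l) S.μ)
    (i : V) (l : ℕ) :
    ∫ ω, N.inflow (y ω) i l ∂S.μ = N.inflow (fun i j l => ∫ ω, y ω i j l ∂S.μ) i l :=
  integral_finsetSum _ fun j _ => h j i l

end Integrals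

variable (S) in
/-- The backlog process under the decisions `x`. -/
noncomputable def backlog (x : ℕ → S.Ω → Flow V) (t : ℕ) (ω : S.Ω) (i : V) (l : ℕ) : ℝ :=
  N.queue (fun s => x s ω) (fun s => S.arr s ω) t i l

lemma integrable_backlog_succ {x : ℕ → S.Ω → Flow V} {t : ℕ}
    (hq : ∀ i l, Integrable (fun ω => S.backlog x t ω i l) S.μ)
    (hx : ∀ i j l, Integrable (fun ω => x t ω i j l) S.μ) (i : V) (l : ℕ) :
    Integrable (fun ω => S.backlog x (t + 1) ω i l) S.μ := by
  by_cases h : i ≠ N.dest ∧ l ∈ Finset.Icc 1 N.L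
  · simp only [backlog, queue_succ _ _ t h.1 h.2]
    exact (((hq i (l + 1)).sub (integrable_outflow hx i (l + 1))).add
      (integrable_inflow hx i (l + 1))).add (S.integrable_arr t i l)
  · simp only [backlog, queue, if_neg h]
    exact integrable_zero _ _ _

/-- The queue recursion is linear, so mean backlogs are driven by mean flows and arrival rates
alone. -/
lemma integral_backlog_succ {x : ℕ → S.Ω → Flow V} {t : ℕ}
    (hq : ∀ i l, Integrable (fun ω => S.backlog x t ω i l) S.μ)
    (hx : ∀ i j l, Integrable (fun ω => x t ω i j l) S.μ) {i : V} (hi : i ≠ N.dest) {l : ℕ}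
    (hl : l ∈ Finset.Icc 1 N.L) :
    ∫ ω, S.backlog x (t + 1) ω i l ∂S.μ = ∫ ω, S.backlog x t ω i (l + 1) ∂S.μ
      - N.outflow (fun i j l => ∫ ω, x t ω i j l ∂S.μ) i (l + 1)
      + N.inflow (fun i j l => ∫ ω, x t ω i j l ∂S.μ) i (l + 1) + S.rate i l := by
  have ho := integrable_outflow hx i (l + 1)
  have hi' := integrable_inflow hx i (l + 1)
  have h1 : Integrable
      (fun ω => S.backlog x t ω i (l + 1) - N.outflow (x t ω) i (l + 1)) S.μ :=
    (hq i (l + 1)).sub ho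
  have h2 : Integrable (fun ω => S.backlog x t ω i (l + 1) - N.outflow (x t ω) i (l + 1)
      + N.inflow (x t ω) i (l + 1)) S.μ :=
    h1.add hi'
  rw [← integral_outflow hx, ← integral_inflow hx, ← S.integral_arr t,
    ← integral_sub (hq i (l + 1)) ho, ← integral_add h1 hi',
    ← integral_add h2 (S.integrable_arr t i l)]
  exact integral_congr_ae (.of_forall fun ω => queue_succ _ _ t hi hl)

variable (S) in
/-- The single-letter description of the achievable flow assignments. -/
structure IsAssignment (γ : ℝ) (z : Flow V) : Prop where
  decision : N.IsDecision z
  capacity : ∀ i j, N.graph.Adj i j → N.linkFlow z i j ≤ N.cap i j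
  causal : ∀ i, ∀ l ∈ Finset.Icc 1 N.L,
    N.outflowGE z i l ≤ N.inflowGE z i (l + 1) + S.rateGE i l
  reliable : γ * S.totalRate ≤ N.inflowGE z N.dest 1

/-! ### Necessity for both problems, and constant policies. -/

namespace Policy

variable {p : S.Policy} {z : Flow V} {γ : ℝ}

lemma measurable_flow (p : S.Policy) (t : ℕ) (i j : V) (l : ℕ) :
    Measurable fun ω => p.x t ω i j l :=
  (measurable_pi_apply l).comp ((measurable_pi_apply j).comp ((measurable_pi_apply i).comp
    ((p.measurable t).mono (S.past.le t) le_rfl)))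

lemma Achieves.isDecision (hz : p.Achieves z) : N.IsDecision z := by
  have zero : ∀ i j l, (∀ t, ∀ᵐ ω ∂S.μ, p.x t ω i j l = 0) → z i j l = 0 := by
    intro i j l h
    refine (hz i j l).unique ?_
    simpa only [integral_eq_zero_of_ae (h _)] using IsLongRunAvg.const 0
  exact
    { nonneg := fun i j l => (hz i j l).nonneg fun t =>
        integral_nonneg_of_ae ((p.decision t).mono fun ω h => h.nonneg i j l)
      off_links := fun i j l hij => zero i j l fun t =>
        (p.decision t).mono fun ω h => h.off_links i j l hij
      off_lifetimes := fun i j l hl => zero i j l fun t =>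
        (p.decision t).mono fun ω h => h.off_lifetimes i j l hl
      dest_silent := fun j l => zero _ j l fun t =>
        (p.decision t).mono fun ω h => h.dest_silent j l
      lifetime_one := fun i j hj => zero i j 1 fun t =>
        (p.decision t).mono fun ω h => h.lifetime_one i j hj }

lemma Achieves.linkFlow (hz : p.Achieves z)
    (h : ∀ t i j l, Integrable (fun ω => p.x t ω i j l) S.μ) (i j : V) :
    IsLongRunAvg (fun t => ∫ ω, N.linkFlow (p.x t ω) i j ∂S.μ) (N.linkFlow z i j) := by
  have (t : ℕ) : ∫ ω, N.linkFlow (p.x t ω) i j ∂S.μ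
      = ∑ l ∈ Finset.Icc 1 N.L, ∫ ω, p.x t ω i j l ∂S.μ :=
    integral_finsetSum _ fun l _ => h t i j l
  simp only [this]
  exact .sum fun l _ => hz i j l

lemma Achieves.outflowGE (hz : p.Achieves z)
    (h : ∀ t i j l, Integrable (fun ω => p.x t ω i j l) S.μ) (i : V) (l : ℕ) :
    IsLongRunAvg (fun t => ∫ ω, N.outflowGE (p.x t ω) i l ∂S.μ) (N.outflowGE z i l) := by
  have (t : ℕ) : ∫ ω, N.outflowGE (p.x t ω) i l ∂S.μ
      = ∑ k ∈ Finset.Icc l N.L, ∑ j ∈ N.outNbrs i, ∫ ω, p.x t ω i j k ∂S.μ :=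
    (integral_finsetSum _ fun k _ => integrable_outflow (h t) i k).trans
      (Finset.sum_congr rfl fun k _ => integral_outflow (h t) i k)
  simp only [this]
  exact .sum fun k _ => .sum fun j _ => hz i j k

lemma Achieves.inflowGE (hz : p.Achieves z)
    (h : ∀ t i j l, Integrable (fun ω => p.x t ω i j l) S.μ) (i : V) (l : ℕ) :
    IsLongRunAvg (fun t => ∫ ω, N.inflowGE (p.x t ω) i l ∂S.μ) (N.inflowGE z i l) := by
  have (t : ℕ) : ∫ ω, N.inflowGE (p.x t ω) i l ∂S.μ
      = ∑ k ∈ Finset.Icc l N.L, ∑ j ∈ N.inNbrs i, ∫ ω, p.x t ω j i k ∂S.μ :=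
    (integral_finsetSum _ fun k _ => integrable_inflow (h t) i k).trans
      (Finset.sum_congr rfl fun k _ => integral_inflow (h t) i k)
  simp only [this]
  exact .sum fun k _ => .sum fun j _ => hz j i k

lemma Achieves.reliable_iff (hz : p.Achieves z)
    (h : ∀ t i j l, Integrable (fun ω => p.x t ω i j l) S.μ) :
    p.Reliable γ ↔ γ * S.totalRate ≤ N.inflowGE z N.dest 1 := by
  constructor
  · rintro ⟨r, hr, hle⟩
    rwa [← hr.unique (hz.inflowGE h N.dest 1)]
  · exact fun hle => ⟨_, hz.inflowGE h N.dest 1, hle⟩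

/-- Integrability is not part of a policy, yet averages of sums of flows can be split only when the
integrals are genuine. Flows are nonnegative, so an upper bound suffices: the capacity in the
virtual network, the backlog in the first problem. -/
lemma integrable_of_le {t : ℕ} {i j : V} {l : ℕ} {g : S.Ω → ℝ} (hg : Integrable g S.μ)
    (h : ∀ᵐ ω ∂S.μ, p.x t ω i j l ≤ g ω) : Integrable (fun ω => p.x t ω i j l) S.μ := by
  refine hg.mono' (p.measurable_flow t i j l).aestronglyMeasurable ?_
  filter_upwards [h, p.decision t] with ω hω hd
  rwa [Real.norm_of_nonneg (hd.nonneg i j l)]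

lemma Feasible₂.integrable (hp : p.Feasible₂ γ) (t : ℕ) (i j : V) (l : ℕ) :
    Integrable (fun ω => p.x t ω i j l) S.μ := by
  refine integrable_of_le (integrable_const (N.cap i j)) ?_
  filter_upwards [hp.peak_capacity t, p.decision t] with ω hc hd
  by_cases hij : N.graph.Adj i j
  · exact (hd.le_linkFlow i j l).trans (hc i j hij)
  · rw [hd.off_links i j l hij]
    exact N.cap_nonneg i j

lemma Feasible₂.isAssignment (hp : p.Feasible₂ γ) (hz : p.Achieves z) : S.IsAssignment γ z where
  decision := hz.isDecision
  capacity i j hij := by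
    refine (hz.linkFlow hp.integrable i j).le_of_potential (IsLongRunAvg.const _)
      (q := fun _ => 0) rfl (fun _ => le_rfl) fun t => ?_
    simp only [zero_add]
    have hint : Integrable (fun ω => N.linkFlow (p.x t ω) i j) S.μ :=
      integrable_finsetSum _ fun l _ => hp.integrable t i j l
    calc ∫ ω, N.linkFlow (p.x t ω) i j ∂S.μ ≤ ∫ _, N.cap i j ∂S.μ :=
          integral_mono_ae hint (integrable_const _)
            ((hp.peak_capacity t).mono fun ω h => h i j hij)
      _ = N.cap i j := by simp
  causal i l hl := by
    obtain ⟨u, v, hu, hv, huv⟩ := hp.causal i l hl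
    rwa [← hu.unique (hz.outflowGE hp.integrable i l),
      ← hv.unique (hz.inflowGE hp.integrable i (l + 1))]
  reliable := (hz.reliable_iff hp.integrable).1 hp.reliable

/-- The policy that makes the same decision in every slot. -/
def const (S : N.Arrivals) (hz : N.IsDecision z) : S.Policy where
  x _ _ := z
  measurable _ := measurable_const
  decision _ := .of_forall fun _ => hz
  avg_exists i j l := ⟨z i j l, by simpa using IsLongRunAvg.const (z i j l)⟩

lemma const_achieves (hz : N.IsDecision z) : (const S hz).Achieves z := fun i j l => by
  simpa [const] using IsLongRunAvg.const (z i j l)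

lemma const_feasible₂ (hz : S.IsAssignment γ z) : (const S hz.decision).Feasible₂ γ := by
  have hint : ∀ t i j l, Integrable (fun ω => (const S hz.decision).x t ω i j l) S.μ :=
    fun t i j l => integrable_const (z i j l)
  have hach := const_achieves (S := S) hz.decision
  exact
    { reliable := (hach.reliable_iff hint).2 hz.reliable
      peak_capacity := fun _ => .of_forall fun _ => hz.capacity
      causal := fun i l hl => ⟨_, _, hach.outflowGE hint i l, hach.inflowGE hint i (l + 1),
        hz.causal i l hl⟩ }

lemma Feasible₁.integrable_of_backlog (hp : p.Feasible₁ γ) {t : ℕ}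
    (hq : ∀ i l, Integrable (fun ω => S.backlog p.x t ω i l) S.μ) (i j : V) (l : ℕ) :
    Integrable (fun ω => p.x t ω i j l) S.μ := by
  refine integrable_of_le (hq i l) ?_
  filter_upwards [hp.available t, p.decision t] with ω ha hd
  by_cases hl : l ∈ Finset.Icc 1 N.L
  · exact (hd.le_outflow i j l).trans (ha i l hl)
  · rw [hd.off_lifetimes i j l hl, backlog, queue_off _ _ t i hl]

/-- Integrability alternates between backlog and flow: the backlog dominates the flow of the same
slot, and the two together with the arrivals give the next backlog. -/
lemma Feasible₁.integrable_backlog (hp : p.Feasible₁ γ) (t : ℕ) (i : V) (l : ℕ) :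
    Integrable (fun ω => S.backlog p.x t ω i l) S.μ := by
  induction t generalizing i l with
  | zero => simp [backlog]
  | succ t ih => exact integrable_backlog_succ ih (hp.integrable_of_backlog ih) i l

lemma Feasible₁.integrable (hp : p.Feasible₁ γ) (t : ℕ) (i j : V) (l : ℕ) :
    Integrable (fun ω => p.x t ω i j l) S.μ :=
  hp.integrable_of_backlog (hp.integrable_backlog t) i j l

lemma Feasible₁.backlog_nonneg (hp : p.Feasible₁ γ) (t : ℕ) :
    ∀ᵐ ω ∂S.μ, ∀ i l, 0 ≤ S.backlog p.x t ω i l := by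
  filter_upwards [hp.available t, p.decision t] with ω ha hd i l
  by_cases hl : l ∈ Finset.Icc 1 N.L
  · exact (hd.outflow_nonneg i l).trans (ha i l hl)
  · rw [backlog, queue_off _ _ t i hl]

lemma Feasible₁.causal (hp : p.Feasible₁ γ) (hz : p.Achieves z) {i : V} (hi : i ≠ N.dest) {l : ℕ}
    (hl : l ∈ Finset.Icc 1 N.L) :
    N.outflowGE z i l ≤ N.inflowGE z i (l + 1) + S.rateGE i l := by
  have hq (t : ℕ) : Integrable (fun ω => ∑ k ∈ Finset.Icc l N.L, S.backlog p.x t ω i k) S.μ :=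
    integrable_finsetSum _ fun k _ => hp.integrable_backlog t i k
  have ha (t : ℕ) : Integrable (fun ω => ∑ k ∈ Finset.Icc l N.L, S.arr t ω i k) S.μ :=
    integrable_finsetSum _ fun k _ => S.integrable_arr t i k
  have ea (t : ℕ) : ∫ ω, ∑ k ∈ Finset.Icc l N.L, S.arr t ω i k ∂S.μ = S.rateGE i l := by
    rw [integral_finsetSum _ fun k _ => S.integrable_arr t i k, rateGE]
    exact Finset.sum_congr rfl fun k _ => S.integral_arr t i k
  have ho (t : ℕ) := integrable_outflowGE (hp.integrable t) i l
  have hi' (t : ℕ) := integrable_inflowGE (hp.integrable t) i (l + 1)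
  have hia (t : ℕ) : Integrable (fun ω =>
      N.inflowGE (p.x t ω) i (l + 1) + ∑ k ∈ Finset.Icc l N.L, S.arr t ω i k) S.μ :=
    (hi' t).add (ha t)
  refine (hz.outflowGE hp.integrable i l).le_of_potential
    ((hz.inflowGE hp.integrable i (l + 1)).add (.const (S.rateGE i l)))
    (q := fun t => ∫ ω, ∑ k ∈ Finset.Icc l N.L, S.backlog p.x t ω i k ∂S.μ) ?_ (fun t => ?_)
    fun t => ?_
  · simp [backlog]
  · exact integral_nonneg_of_ae
      ((hp.backlog_nonneg t).mono fun ω h => Finset.sum_nonneg fun k _ => h i k)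
  · rw [← ea t, ← integral_add (hi' t) (ha t), ← integral_add (hq t) (hia t),
      ← integral_add (hq (t + 1)) (ho t)]
    refine integral_mono_ae ((hq (t + 1)).add (ho t)) ((hq t).add (hia t)) ?_
    filter_upwards [hp.available t, p.decision t] with ω hav hd
    exact sum_queue_succ_add_outflowGE_le hd hi hl (hav i l hl)

lemma Feasible₁.isAssignment (hp : p.Feasible₁ γ) (hz : p.Achieves z) : S.IsAssignment γ z where
  decision := hz.isDecision
  capacity i j hij := by
    obtain ⟨c, hc, hle⟩ := hp.avg_capacity i j hij
    rwa [← hc.unique (hz.linkFlow hp.integrable i j)]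
  causal i l hl := by
    -- The drift bound does not cover the destination, whose queue is reset to `0`; there the left
    -- side vanishes because nothing is sent.
    by_cases hi : i = N.dest
    · subst hi
      rw [Network.outflowGE, Finset.sum_eq_zero fun k _ => hz.isDecision.outflow_dest k]
      exact add_nonneg (hz.isDecision.inflowGE_nonneg _ _) (S.rateGE_nonneg _ _)
    · exact hp.causal hz hi hl
  reliable := (hz.reliable_iff hp.integrable).1 hp.reliable

end Policy

/-! ### The proportional policy: sufficiency for the first problem. -/

section Proportional

variable (S) in
/-- The mean backlogs under which the assignment `z` is carried in equilibrium. -/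
noncomputable def meanBacklog (z : Flow V) (i : V) (l : ℕ) : ℝ :=
  N.inflowGE z i (l + 1) + S.rateGE i l - N.outflowGE z i (l + 1)

variable {z : Flow V} {γ : ℝ}

/-- This is the fixed-point equation of the mean queue recursion, obtained by peeling the lowest
lifetime off each tail sum. -/
lemma meanBacklog_eq_succ (z : Flow V) (i : V) {l : ℕ} (hl : l < N.L) :
    S.meanBacklog z i l = S.meanBacklog z i (l + 1) - N.outflow z i (l + 1)
      + N.inflow z i (l + 1) + S.rate i l := by
  have h1 : N.inflowGE z i (l + 1) = N.inflow z i (l + 1) + N.inflowGE z i (l + 1 + 1) :=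
    sum_Icc_eq_add hl
  have h2 : N.outflowGE z i (l + 1) = N.outflow z i (l + 1) + N.outflowGE z i (l + 1 + 1) :=
    sum_Icc_eq_add hl
  have h3 : S.rateGE i l = S.rate i l + S.rateGE i (l + 1) := sum_Icc_eq_add hl.le
  rw [meanBacklog, meanBacklog, h1, h2, h3]
  ring

lemma meanBacklog_top (z : Flow V) (i : V) : S.meanBacklog z i N.L = S.rate i N.L := by
  simp [meanBacklog, inflowGE, outflowGE, rateGE]

lemma IsAssignment.outflow_le (hz : S.IsAssignment γ z) (i : V) {l : ℕ}
    (hl : l ∈ Finset.Icc 1 N.L) : N.outflow z i l ≤ S.meanBacklog z i l := by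
  have h := hz.causal i l hl
  have e : N.outflowGE z i l = N.outflow z i l + N.outflowGE z i (l + 1) :=
    sum_Icc_eq_add (Finset.mem_Icc.1 hl).2
  rw [meanBacklog]
  linarith

lemma IsAssignment.meanBacklog_nonneg (hz : S.IsAssignment γ z) (i : V) {l : ℕ}
    (hl : l ∈ Finset.Icc 1 N.L) : 0 ≤ S.meanBacklog z i l :=
  (hz.decision.outflow_nonneg i l).trans (hz.outflow_le i hl)

/-- The fraction of the backlog of node `i` that the proportional policy sends to node `j`. -/
noncomputable def share (S : N.Arrivals) (z : Flow V) : Flow V :=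
  fun i j l => z i j l / S.meanBacklog z i l

lemma IsAssignment.share_nonneg (hz : S.IsAssignment γ z) (i j : V) (l : ℕ) :
    0 ≤ S.share z i j l := by
  by_cases hl : l ∈ Finset.Icc 1 N.L
  · exact div_nonneg (hz.decision.nonneg i j l) (hz.meanBacklog_nonneg i hl)
  · simp [share, hz.decision.off_lifetimes i j l hl]

/-- If the mean backlog is `0`, division gives share `0`; this is harmless, since `z i j l` lies
between `0` and the mean backlog and so vanishes too. -/
lemma IsAssignment.share_mul_meanBacklog (hz : S.IsAssignment γ z) (i j : V) {l : ℕ}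
    (hl : l ∈ Finset.Icc 1 N.L) : S.share z i j l * S.meanBacklog z i l = z i j l := by
  refine div_mul_cancel_of_imp fun h => ?_
  exact le_antisymm (h ▸ (hz.decision.le_outflow i j l).trans (hz.outflow_le i hl))
    (hz.decision.nonneg i j l)

lemma IsAssignment.outflow_share_le_one (hz : S.IsAssignment γ z) (i : V) {l : ℕ}
    (hl : l ∈ Finset.Icc 1 N.L) : N.outflow (S.share z) i l ≤ 1 := by
  simp only [outflow, share, ← Finset.sum_div]
  exact div_le_one_of_le₀ (hz.outflow_le i hl) (hz.meanBacklog_nonneg i hl)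

open Classical in
/-- The backlogs when every node sends fixed fractions `p` of them in each slot. -/
noncomputable def shareQueue (N : Network V) (p : Flow V) (a : ℕ → V → ℕ → ℝ) :
    ℕ → V → ℕ → ℝ
  | 0, _, _ => 0
  | t + 1, i, l =>
    if i ≠ N.dest ∧ l ∈ Finset.Icc 1 N.L then
      shareQueue N p a t i (l + 1)
        - N.outflow (fun i j l => p i j l * shareQueue N p a t i l) i (l + 1)
        + N.inflow (fun i j l => p i j l * shareQueue N p a t i l) i (l + 1) + a t i l
    else 0

/-- Decisions depend on the backlog and the backlog on earlier decisions. The closed recursion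
`shareQueue` breaks this circle, and here it is identified with the true queue. -/
lemma queue_eq_shareQueue (p : Flow V) (a : ℕ → V → ℕ → ℝ) (t : ℕ) (i : V) (l : ℕ) :
    N.queue (fun t i j l => p i j l * shareQueue N p a t i l) a t i l
      = shareQueue N p a t i l := by
  induction t generalizing i l with
  | zero => simp [shareQueue]
  | succ t ih => rw [queue, shareQueue, ih]

lemma outflow_mul (p : Flow V) (q : V → ℕ → ℝ) (i : V) (l : ℕ) :
    N.outflow (fun i j l => p i j l * q i l) i l = N.outflow p i l * q i l := by
  simp only [outflow, Finset.sum_mul]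

lemma shareQueue_nonneg {p : Flow V} {a : ℕ → V → ℕ → ℝ} (hp : ∀ i j l, 0 ≤ p i j l)
    (hp_le : ∀ i, ∀ l ∈ Finset.Icc 1 N.L, N.outflow p i l ≤ 1) (ha : ∀ t i l, 0 ≤ a t i l)
    (t : ℕ) (i : V) (l : ℕ) : 0 ≤ shareQueue N p a t i l := by
  induction t generalizing i l with
  | zero => simp [shareQueue]
  | succ t ih =>
    rw [shareQueue]
    split_ifs with h
    · have h1 : N.outflow (fun i j l => p i j l * shareQueue N p a t i l) i (l + 1)
          ≤ shareQueue N p a t i (l + 1) := by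
        rw [outflow_mul]
        -- The shares are bounded only on effective lifetimes; for `l = L` the queue at `L + 1` is
        -- empty.
        by_cases hl : l + 1 ∈ Finset.Icc 1 N.L
        · exact mul_le_of_le_one_left (ih i (l + 1)) (hp_le i (l + 1) hl)
        · have : shareQueue N p a t i (l + 1) = 0 := by
            rw [← queue_eq_shareQueue, queue_off _ _ t i hl]
          simp [this]
      have h2 : 0 ≤ N.inflow (fun i j l => p i j l * shareQueue N p a t i l) i (l + 1) :=
        Finset.sum_nonneg fun j _ => mul_nonneg (hp j i _) (ih j _)
      linarith [ha t i l]
    · exact le_rfl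

/-- The backlog at slot `t` involves arrivals of earlier slots only, so the policy is admissible. -/
lemma measurable_shareQueue (S : N.Arrivals) (p : Flow V) (t : ℕ) (i : V) (l : ℕ) :
    Measurable[S.past t] fun ω => shareQueue N p (fun s => S.arr s ω) t i l := by
  induction t generalizing i l with
  | zero => exact measurable_const
  | succ t ih =>
    have ih' (i : V) (l : ℕ) :
        Measurable[S.past (t + 1)] fun ω => shareQueue N p (fun s => S.arr s ω) t i l :=
      (ih i l).mono (S.past.mono t.le_succ) le_rfl
    by_cases h : i ≠ N.dest ∧ l ∈ Finset.Icc 1 N.L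
    · simp only [shareQueue, if_pos h]
      exact (((ih' i (l + 1)).sub
        (Finset.measurable_fun_sum _ fun j _ => (ih' i (l + 1)).const_mul (p i j (l + 1)))).add
        (Finset.measurable_fun_sum _ fun j _ => (ih' j (l + 1)).const_mul (p j i (l + 1)))).add
        (S.measurable_arr t i l)
    · simp only [shareQueue, if_neg h]
      exact measurable_const

lemma arr_nonneg (S : N.Arrivals) : ∀ᵐ ω ∂S.μ, ∀ t i l, 0 ≤ S.arr t ω i l := by
  obtain ⟨A, hA⟩ := S.bounded
  filter_upwards [ae_all_iff.2 hA] with ω h t i l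
  exact (h t i l).1

variable (S) in
/-- The proportional policy: each node sends fixed shares of its backlogs. -/
noncomputable def proportionalFlow (z : Flow V) (t : ℕ) (ω : S.Ω) : Flow V := fun i j l =>
  S.share z i j l * shareQueue N (S.share z) (fun s => S.arr s ω) t i l

lemma backlog_proportionalFlow (z : Flow V) (t : ℕ) (ω : S.Ω) (i : V) (l : ℕ) :
    S.backlog (S.proportionalFlow z) t ω i l
      = shareQueue N (S.share z) (fun s => S.arr s ω) t i l :=
  queue_eq_shareQueue _ _ t i l

lemma proportionalFlow_apply (z : Flow V) (t : ℕ) (ω : S.Ω) (i j : V) (l : ℕ) :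
    S.proportionalFlow z t ω i j l
      = S.share z i j l * S.backlog (S.proportionalFlow z) t ω i l := by
  rw [backlog_proportionalFlow, proportionalFlow]

lemma integrable_backlog_proportionalFlow (z : Flow V) (t : ℕ) (i : V) (l : ℕ) :
    Integrable (fun ω => S.backlog (S.proportionalFlow z) t ω i l) S.μ := by
  induction t generalizing i l with
  | zero => simp [backlog]
  | succ t ih =>
    refine integrable_backlog_succ ih (fun i j l => ?_) i l
    simp only [proportionalFlow_apply z t]
    exact (ih i l).const_mul _

lemma integrable_proportionalFlow (z : Flow V) (t : ℕ) (i j : V) (l : ℕ) :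
    Integrable (fun ω => S.proportionalFlow z t ω i j l) S.μ := by
  simp only [proportionalFlow_apply z t]
  exact (integrable_backlog_proportionalFlow z t i l).const_mul _

lemma measurable_proportionalFlow (z : Flow V) (t : ℕ) :
    Measurable[S.past t] (S.proportionalFlow z t) := by
  let _ := S.past t
  exact measurable_pi_iff.2 fun i => measurable_pi_iff.2 fun _ => measurable_pi_iff.2 fun l =>
    (S.measurable_shareQueue _ t i l).const_mul _

lemma share_eq_zero {i j : V} {l : ℕ} (h : z i j l = 0) : S.share z i j l = 0 := by
  rw [share, h, zero_div]

lemma IsAssignment.backlog_proportionalFlow_nonneg (hz : S.IsAssignment γ z) :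
    ∀ᵐ ω ∂S.μ, ∀ t i l, 0 ≤ S.backlog (S.proportionalFlow z) t ω i l := by
  filter_upwards [S.arr_nonneg] with ω ha t i l
  rw [backlog_proportionalFlow]
  exact shareQueue_nonneg hz.share_nonneg (fun i l hl => hz.outflow_share_le_one i hl) ha t i l

lemma IsAssignment.isDecision_proportionalFlow (hz : S.IsAssignment γ z) (t : ℕ) :
    ∀ᵐ ω ∂S.μ, N.IsDecision (S.proportionalFlow z t ω) := by
  have zero {i j l} (h : z i j l = 0) (ω : S.Ω) : S.proportionalFlow z t ω i j l = 0 := by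
    rw [proportionalFlow, share_eq_zero h, zero_mul]
  filter_upwards [hz.backlog_proportionalFlow_nonneg] with ω hq
  exact
    { nonneg := fun i j l => by
        rw [proportionalFlow_apply]
        exact mul_nonneg (hz.share_nonneg i j l) (hq t i l)
      off_links := fun i j l h => zero (hz.decision.off_links i j l h) ω
      off_lifetimes := fun i j l h => zero (hz.decision.off_lifetimes i j l h) ω
      dest_silent := fun j l => zero (hz.decision.dest_silent j l) ω
      lifetime_one := fun i j h => zero (hz.decision.lifetime_one i j h) ω }

/-- The destination can be left out of `h`: its queue is always empty, and it sends nothing under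
`z`. -/
lemma IsAssignment.integral_proportionalFlow_of_backlog (hz : S.IsAssignment γ z) {t l : ℕ}
    (h : ∀ i ≠ N.dest,
      ∫ ω, S.backlog (S.proportionalFlow z) t ω i l ∂S.μ = S.meanBacklog z i l)
    (i j : V) : ∫ ω, S.proportionalFlow z t ω i j l ∂S.μ = z i j l := by
  simp only [proportionalFlow_apply z t, integral_const_mul]
  by_cases h0 : z i j l = 0
  · rw [share_eq_zero h0, h0, zero_mul]
  · have hi : i ≠ N.dest := fun hi => h0 (hi ▸ hz.decision.dest_silent j l)
    have hl : l ∈ Finset.Icc 1 N.L := by_contra fun hl => h0 (hz.decision.off_lifetimes i j l hl)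
    rw [h i hi, hz.share_mul_meanBacklog i j hl]

/-- Backlog of lifetime `l` is built from lifetime `l + 1` one slot earlier and fresh arrivals, so
equilibrium spreads downward from lifetime `L`, one lifetime per slot. Here `n = L - l` counts the
steps. -/
lemma IsAssignment.integral_backlog_proportionalFlow (hz : S.IsAssignment γ z) (n : ℕ) {l t : ℕ}
    (hl : 1 ≤ l) (hn : l + n = N.L) (ht : n < t) {i : V} (hi : i ≠ N.dest) :
    ∫ ω, S.backlog (S.proportionalFlow z) t ω i l ∂S.μ = S.meanBacklog z i l := by
  induction n generalizing l t i with
  | zero =>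
    obtain ⟨t, rfl⟩ : ∃ s, t = s + 1 := ⟨t - 1, by omega⟩
    obtain rfl : l = N.L := hn
    have hL : N.L + 1 ∉ Finset.Icc 1 N.L := by simp
    have hx (i j : V) : ∫ ω, S.proportionalFlow z t ω i j (N.L + 1) ∂S.μ = 0 := by
      simp [proportionalFlow, share, hz.decision.off_lifetimes i j _ hL]
    -- At lifetime `L` only fresh arrivals contribute.
    rw [integral_backlog_succ (integrable_backlog_proportionalFlow z t)
      (integrable_proportionalFlow z t) hi (Finset.mem_Icc.2 ⟨hl, le_rfl⟩), meanBacklog_top]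
    simp [backlog, queue_off _ _ t i hL, outflow, inflow, hx]
  | succ n ih =>
    obtain ⟨t, rfl⟩ : ∃ s, t = s + 1 := ⟨t - 1, by omega⟩
    have hq (i : V) (hi : i ≠ N.dest) : ∫ ω, S.backlog (S.proportionalFlow z) t ω i (l + 1) ∂S.μ
        = S.meanBacklog z i (l + 1) :=
      ih (by omega) (by omega) (by omega) hi
    rw [integral_backlog_succ (integrable_backlog_proportionalFlow z t)
      (integrable_proportionalFlow z t) hi (Finset.mem_Icc.2 ⟨hl, by omega⟩), hq i hi,
      meanBacklog_eq_succ z i (l := l) (by omega)]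
    simp only [outflow, inflow, hz.integral_proportionalFlow_of_backlog hq]

lemma IsAssignment.integral_proportionalFlow (hz : S.IsAssignment γ z) {t : ℕ} (ht : N.L ≤ t)
    (i j : V) (l : ℕ) : ∫ ω, S.proportionalFlow z t ω i j l ∂S.μ = z i j l := by
  by_cases hl : l ∈ Finset.Icc 1 N.L
  · have hl' := Finset.mem_Icc.1 hl
    exact hz.integral_proportionalFlow_of_backlog (fun i hi =>
      -- Since `l ≥ 1`, `L - l < L ≤ t`.
      hz.integral_backlog_proportionalFlow (N.L - l) hl'.1 (by omega) (by omega) hi) i j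
  · simp [proportionalFlow, share, hz.decision.off_lifetimes i j l hl]

lemma IsAssignment.isLongRunAvg_proportionalFlow (hz : S.IsAssignment γ z) (i j : V) (l : ℕ) :
    IsLongRunAvg (fun t => ∫ ω, S.proportionalFlow z t ω i j l ∂S.μ) (z i j l) :=
  .of_tendsto <| tendsto_const_nhds.congr' <| (eventually_ge_atTop N.L).mono fun _ ht =>
    (hz.integral_proportionalFlow ht i j l).symm

/-- The proportional policy carrying the assignment `z`. -/
noncomputable def IsAssignment.proportional (hz : S.IsAssignment γ z) : S.Policy where
  x := S.proportionalFlow z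
  measurable := measurable_proportionalFlow z
  decision := hz.isDecision_proportionalFlow
  avg_exists i j l := ⟨z i j l, hz.isLongRunAvg_proportionalFlow i j l⟩

lemma IsAssignment.proportional_achieves (hz : S.IsAssignment γ z) : hz.proportional.Achieves z :=
  hz.isLongRunAvg_proportionalFlow

lemma IsAssignment.proportional_feasible₁ (hz : S.IsAssignment γ z) :
    hz.proportional.Feasible₁ γ where
  reliable := (hz.proportional_achieves.reliable_iff (integrable_proportionalFlow z)).2 hz.reliable
  avg_capacity i j hij := ⟨_, hz.proportional_achieves.linkFlow (integrable_proportionalFlow z) i j,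
    hz.capacity i j hij⟩
  available t := by
    filter_upwards [hz.backlog_proportionalFlow_nonneg] with ω hq i l hl
    have e : N.outflow (S.proportionalFlow z t ω) i l
        = N.outflow (S.share z) i l * S.backlog (S.proportionalFlow z) t ω i l := by
      rw [backlog_proportionalFlow, ← outflow_mul]
      rfl
    exact e.trans_le (mul_le_of_le_one_left (hq t i l) (hz.outflow_share_le_one i hl))

end Proportional

/-! ### Flow spaces and stability regions. -/

lemma flowSpace₁_eq (S : N.Arrivals) (γ : ℝ) : S.flowSpace₁ γ = {z | S.IsAssignment γ z} :=
  Set.ext fun _ => ⟨fun ⟨_, hp, hz⟩ => hp.isAssignment hz,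
    fun hz => ⟨_, hz.proportional_feasible₁, hz.proportional_achieves⟩⟩

lemma flowSpace₂_eq (S : N.Arrivals) (γ : ℝ) : S.flowSpace₂ γ = {z | S.IsAssignment γ z} :=
  Set.ext fun _ => ⟨fun ⟨_, hp, hz⟩ => hp.isAssignment hz,
    fun hz => ⟨_, Policy.const_feasible₂ hz, Policy.const_achieves hz.decision⟩⟩

lemma flowSpace₁_eq_flowSpace₂ (S : N.Arrivals) (γ : ℝ) : S.flowSpace₁ γ = S.flowSpace₂ γ := by
  rw [flowSpace₁_eq, flowSpace₂_eq]

lemma Policy.exists_achieves (p : S.Policy) : ∃ z, p.Achieves z := by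
  choose z hz using p.avg_exists
  exact ⟨z, hz⟩

/-- A policy carries the existence of its averages, so every feasible policy contributes a point to
the flow space. -/
lemma exists_feasible₁_iff (S : N.Arrivals) (γ : ℝ) :
    (∃ p : S.Policy, p.Feasible₁ γ) ↔ (S.flowSpace₁ γ).Nonempty :=
  ⟨fun ⟨p, hp⟩ => p.exists_achieves.imp fun _ hz => ⟨p, hp, hz⟩, fun ⟨_, p, hp, _⟩ => ⟨p, hp⟩⟩

lemma exists_feasible₂_iff (S : N.Arrivals) (γ : ℝ) :
    (∃ p : S.Policy, p.Feasible₂ γ) ↔ (S.flowSpace₂ γ).Nonempty :=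
  ⟨fun ⟨p, hp⟩ => p.exists_achieves.imp fun _ hz => ⟨p, hp, hz⟩, fun ⟨_, p, hp, _⟩ => ⟨p, hp⟩⟩

end Arrivals

end Network

theorem proposition2 {V : Type v} [Fintype V] (N : Network V) :
    N.stabilityRegion₁ = N.stabilityRegion₂ ∧
    ∀ (rate : V → ℕ → ℝ) (γ : ℝ), (rate, γ) ∈ N.stabilityRegion₁ →
      ∀ S : Network.Arrivals.{v, u} N, S.rate = rate →
        S.flowSpace₁ γ = S.flowSpace₂ γ := by
  refine ⟨?_, fun _ γ _ S _ => S.flowSpace₁_eq_flowSpace₂ γ⟩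
  simp only [Network.stabilityRegion₁, Network.stabilityRegion₂,
    Network.Arrivals.exists_feasible₁_iff, Network.Arrivals.exists_feasible₂_iff,
    Network.Arrivals.flowSpace₁_eq_flowSpace₂]
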